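/- **Theorem 5.1 (equality case of Prékopa–Leindler).** Let $n\ge 1$ and $\lambda\in(0,1)$, and let $\phi_0,\phi_1,\phi_\lambda:\mathbb R^n\to[0,\infty)$ be continuous and compactly supported, with $\int_{\mathbb R^n}\phi_0\,dx>0$ and $\int_{\mathbb R^n}\phi_1\,dx>0$. Suppose that $$\phi_\lambda((1-\lambda)y+\lambda z)\ \ge\ \phi_0(y)^{1-\lambda}\,\phi_1(z)^{\lambda}\qquad\text{for all } y,z\in\mathbb R^n,$$ and that $$\int_{\mathbb R^n}\phi_\lambda(x)\,dx=\Big(\int_{\mathbb R^n}\phi_0(x)\,dx\Big)^{1-\lambda}\Big(\int_{\mathbb R^n}\phi_1(x)\,dx\Big)^{\lambda}.$$ Then $\phi_0,\phi_1,\phi_\lambda$ are log-concave in $\mathbb R^n$, where a function $v:\mathbb R^n\to[0,\infty)$ is called log-concave if $v((1-\mu)y+\mu z)\ge v(y)^{1-\mu}v(z)^{\mu}$ for all $y,z\in\mathbb R^n$ and all $\mu\in(0,1)$. Moreover, there exist $\eta\in\mathbb R^n$ and $k>0$ such that $$\phi_0(x)=k\,\phi_1(x+\eta)=k^{\lambda}\,\phi_\lambda(x+\lambda\eta)\qquad\text{for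 all } x\in\mathbb R^n.$$ -/

import Mathlib

/-- A nonnegative function `v` on `ℝⁿ` is log-concave if
`v ((1 - μ) y + μ z) ≥ v(y)^(1 - μ) * v(z)^μ` for all points `y`, `z` and all `μ ∈ (0, 1)`.
(The right side is `0` as soon as `v y = 0` or `v z = 0`, since both exponents are positive.) -/
def IsLogConcave {n : ℕ} (v : EuclideanSpace ℝ (Fin n) → ℝ) : Prop :=
  (∀ x, 0 ≤ v x) ∧
    ∀ (y z : EuclideanSpace ℝ (Fin n)) (μ : ℝ), 0 < μ → μ < 1 →
      v y ^ (1 - μ) * v z ^ μ ≤ v ((1 - μ) • y + μ • z)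

open MeasureTheory Set Filter Topology ProbabilityTheory
open scoped ENNReal Pointwise InnerProductSpace

/-! The equality case is reduced to the line by smoothed projections. After normalising all
integrals to one, project each function along a vector `u` and convolve with a standard Gaussian.
Since the Gaussian density is jointly log-concave in mean and point, the Prékopa–Leindler inequality
on the whole space shows that the three marginals again satisfy the hypothesis
(`gaussianMarginal_prekopaLeindler`). They still have mass one, and are now positive and continuous,
so monotone transport is available.

On the line, transporting one density to the other turns equality of integrals into pointwise
equality in a Bernoulli inequality. The transport then has derivative one and is a translation
(`exists_translate_of_prekopaLeindler_eq`).

The shift depends on `u`, but comparing first moments shows that it is the inner product of `u` with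
the difference of barycentres. Fourier transforms then recover the functions from their marginals,
giving translates in the whole space. Substituting these back into the hypothesis gives
log-concavity for the weight `lam`, and continuity extends it to all weights. -/

/-! ### The Prékopa–Leindler inequality -/

/-- One-dimensional Brunn–Minkowski inequality for nonempty compact sets. -/
theorem volume_le_of_combination_subset {lam : ℝ} (h0 : 0 < lam) (h1 : lam < 1) {A B C : Set ℝ}
    (hA : IsCompact A) (hB : IsCompact B) (hA' : A.Nonempty) (hB' : B.Nonempty)
    (hC : ∀ y ∈ A, ∀ z ∈ B, (1 - lam) * y + lam * z ∈ C) :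
    ENNReal.ofReal (1 - lam) * volume A + ENNReal.ofReal lam * volume B ≤ volume C := by
  obtain ⟨a, ha, hamax⟩ := hA.exists_isGreatest hA'
  obtain ⟨b, hb, hbmin⟩ := hB.exists_isLeast hB'
  have hvol : ∀ (c d : ℝ), 0 < c → ∀ S : Set ℝ,
      volume ((fun x => c * x + d) '' S) = ENNReal.ofReal c * volume S := by
    intro c d hc S
    have : (fun x => c * x + d) '' S = (fun x => x + d) '' (c • S) := by
      rw [← image_smul, image_image]; rfl
    rw [this, image_add_right, measure_preimage_add_right, Measure.addHaar_smul]
    simp [abs_of_pos hc]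
  -- Pairing the maximum of `A` with the minimum of `B` makes the two pieces lie on opposite sides
  -- of one common point.
  set S₁ := (fun x => (1 - lam) * x + lam * b) '' A
  set S₂ := (fun x => lam * x + (1 - lam) * a) '' B
  have hS₂ : MeasurableSet S₂ := (hB.image (by fun_prop)).measurableSet
  have hsub : S₁ ∪ S₂ ⊆ C := by
    rintro _ (⟨x, hx, rfl⟩ | ⟨x, hx, rfl⟩)
    · exact hC x hx b hb
    · simpa [add_comm] using hC a ha x hx
  have hinter : S₁ ∩ S₂ ⊆ {(1 - lam) * a + lam * b} := by
    rintro _ ⟨⟨x, hx, rfl⟩, ⟨y, hy, hxy⟩⟩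
    have hxa := hamax hx
    have hyb := hbmin hy
    simp only [mem_singleton_iff] at *
    nlinarith
  have hd : AEDisjoint volume S₁ S₂ := measure_mono_null hinter (by simp)
  calc _ = volume S₁ + volume S₂ := by rw [hvol _ _ (by linarith), hvol _ _ h0]
    _ = volume (S₁ ∪ S₂) := (measure_union₀ hS₂.nullMeasurableSet hd).symm
    _ ≤ volume C := measure_mono hsub

/-- Prékopa–Leindler inequality for continuous compactly supported functions, as a property of the
space. -/
def PrekopaLeindlerSpace (E : Type*) [AddCommGroup E] [Module ℝ E] [TopologicalSpace E]
    [MeasureSpace E] : Prop :=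
  ∀ (lam : ℝ) (f g h : E → ℝ), 0 < lam → lam < 1 →
    (∀ x, 0 ≤ f x) → (∀ x, 0 ≤ g x) → (∀ x, 0 ≤ h x) →
    Continuous f → Continuous g → Continuous h →
    HasCompactSupport f → HasCompactSupport g → HasCompactSupport h →
    (∀ y z, f y ^ (1 - lam) * g z ^ lam ≤ h ((1 - lam) • y + lam • z)) →
    (∫ x, f x) ^ (1 - lam) * (∫ x, g x) ^ lam ≤ ∫ x, h x

theorem HasCompactSupport.isCompact_le {X : Type*} [TopologicalSpace X] {f : X → ℝ}
    (hf : Continuous f) (hs : HasCompactSupport f) {t : ℝ} (ht : 0 < t) :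
    IsCompact {x | t ≤ f x} := by
  refine IsCompact.of_isClosed_subset hs (isClosed_le continuous_const hf) fun x hx => ?_
  refine subset_tsupport f ?_
  have : t ≤ f x := hx
  exact (ht.trans_le this).ne'

/-- Layer-cake formula plus Brunn–Minkowski on superlevel sets. A common maximum makes the
superlevel sets of `f` and `g` nonempty for exactly the same heights. -/
theorem arith_mean_integral_le_of_max_eq_one {lam : ℝ} (h0 : 0 < lam) (h1 : lam < 1)
    {f g h : ℝ → ℝ} (hf0 : ∀ x, 0 ≤ f x) (hg0 : ∀ x, 0 ≤ g x) (hh0 : ∀ x, 0 ≤ h x)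
    (hf : Continuous f) (hg : Continuous g) (hh : Continuous h)
    (hfs : HasCompactSupport f) (hgs : HasCompactSupport g) (hhs : HasCompactSupport h)
    {a b : ℝ} (ha : f a = 1) (hb : g b = 1) (hfa : ∀ x, f x ≤ 1) (hgb : ∀ x, g x ≤ 1)
    (H : ∀ y z, f y ^ (1 - lam) * g z ^ lam ≤ h ((1 - lam) * y + lam * z)) :
    (1 - lam) * (∫ x, f x) + lam * (∫ x, g x) ≤ ∫ x, h x := by
  have key : ENNReal.ofReal (1 - lam) * (∫⁻ x, ENNReal.ofReal (f x)) +
      ENNReal.ofReal lam * (∫⁻ x, ENNReal.ofReal (g x)) ≤ ∫⁻ x, ENNReal.ofReal (h x) := by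
    rw [lintegral_eq_lintegral_meas_le _ (.of_forall hf0) hf.aemeasurable,
      lintegral_eq_lintegral_meas_le _ (.of_forall hg0) hg.aemeasurable,
      lintegral_eq_lintegral_meas_le _ (.of_forall hh0) hh.aemeasurable]
    have hm : ∀ u : ℝ → ℝ, Measurable fun t : ℝ => volume {x : ℝ | t ≤ u x} := fun u =>
      Antitone.measurable fun s t hst => measure_mono fun x hx => le_trans hst hx
    rw [← lintegral_const_mul _ (hm f), ← lintegral_const_mul _ (hm g),
      ← lintegral_add_left ((hm f).const_mul _)]
    refine setLIntegral_mono' measurableSet_Ioi fun t ht => ?_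
    have ht : 0 < t := ht
    by_cases ht1 : t ≤ 1
    · refine volume_le_of_combination_subset h0 h1 (hfs.isCompact_le hf ht)
        (hgs.isCompact_le hg ht) ⟨a, by simpa [ha] using ht1⟩ ⟨b, by simpa [hb] using ht1⟩ ?_
      intro y hy z hz
      have hy : t ≤ f y := hy
      have hz : t ≤ g z := hz
      refine le_trans ?_ (H y z)
      calc t = t ^ (1 - lam) * t ^ lam := by
            rw [← Real.rpow_add ht]; simp
        _ ≤ _ := by
          have := hf0 y
          gcongr
    · have e1 : {x : ℝ | t ≤ f x} = ∅ := by
        ext x; simpa using (hfa x).trans_lt (not_le.1 ht1)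
      have e2 : {x : ℝ | t ≤ g x} = ∅ := by
        ext x; simpa using (hgb x).trans_lt (not_le.1 ht1)
      simp [e1, e2]
  rw [← ofReal_integral_eq_lintegral_ofReal (hf.integrable_of_hasCompactSupport hfs)
      (.of_forall hf0), ← ofReal_integral_eq_lintegral_ofReal
      (hg.integrable_of_hasCompactSupport hgs) (.of_forall hg0),
    ← ofReal_integral_eq_lintegral_ofReal (hh.integrable_of_hasCompactSupport hhs)
      (.of_forall hh0), ← ENNReal.ofReal_mul (by linarith), ← ENNReal.ofReal_mul h0.le,
      ← ENNReal.ofReal_add, ENNReal.ofReal_le_ofReal_iff (integral_nonneg hh0)] at key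
  · exact key
  · exact mul_nonneg (by linarith) (integral_nonneg hf0)
  · exact mul_nonneg h0.le (integral_nonneg hg0)

theorem exists_forall_le_and_pos {X : Type*} [TopologicalSpace X] [MeasureSpace X] {f : X → ℝ}
    (hf0 : ∀ x, 0 ≤ f x) (hf : Continuous f) (hfs : HasCompactSupport f) (hI : ∫ x, f x ≠ 0) :
    ∃ a, 0 < f a ∧ ∀ x, f x ≤ f a := by
  obtain ⟨x₀, hx₀⟩ : ∃ x, f x ≠ 0 := by
    by_contra! hc
    exact hI (by simp [hc])
  have hne : Nonempty X := ⟨x₀⟩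
  obtain ⟨a, ha⟩ := hf.exists_forall_ge_of_hasCompactSupport hfs
  exact ⟨a, ((hf0 x₀).lt_of_ne' hx₀).trans_le (ha x₀), ha⟩

/-- Rescaling both maxima to one gives the arithmetic-mean bound, which dominates the geometric
mean. -/
theorem prekopaLeindlerSpace_real : PrekopaLeindlerSpace ℝ := by
  intro lam f g h h0 h1 hf0 hg0 hh0 hf hg hh hfs hgs hhs H
  have h1' : 0 < 1 - lam := by linarith
  by_cases hIf : ∫ x, f x = 0
  · rw [hIf, Real.zero_rpow h1'.ne', zero_mul]; exact integral_nonneg hh0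
  by_cases hIg : ∫ x, g x = 0
  · rw [hIg, Real.zero_rpow h0.ne', mul_zero]; exact integral_nonneg hh0
  obtain ⟨a, ha, hfa⟩ := exists_forall_le_and_pos hf0 hf hfs hIf
  obtain ⟨b, hb, hgb⟩ := exists_forall_le_and_pos hg0 hg hgs hIg
  set c := f a ^ (1 - lam) * g b ^ lam with hc
  have hcpos : 0 < c := by positivity
  have key := arith_mean_integral_le_of_max_eq_one h0 h1 (f := fun x => (f a)⁻¹ * f x)
    (g := fun x => (g b)⁻¹ * g x) (h := fun x => c⁻¹ * h x) (a := a) (b := b)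
    (fun x => mul_nonneg (inv_nonneg.2 ha.le) (hf0 x))
    (fun x => mul_nonneg (inv_nonneg.2 hb.le) (hg0 x))
    (fun x => mul_nonneg (inv_nonneg.2 hcpos.le) (hh0 x)) (by fun_prop) (by fun_prop) (by fun_prop)
    hfs.mul_left hgs.mul_left hhs.mul_left (by simp [ha.ne']) (by simp [hb.ne'])
    (fun x => by rw [inv_mul_le_iff₀ ha]; simpa using hfa x)
    (fun x => by rw [inv_mul_le_iff₀ hb]; simpa using hgb x)
    (fun y z => by
      rw [Real.mul_rpow (by positivity) (hf0 y), Real.mul_rpow (by positivity) (hg0 z),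
        Real.inv_rpow ha.le, Real.inv_rpow hb.le]
      calc _ = c⁻¹ * (f y ^ (1 - lam) * g z ^ lam) := by rw [hc, mul_inv]; ring
        _ ≤ _ := mul_le_mul_of_nonneg_left (H y z) (by positivity))
  rw [integral_const_mul, integral_const_mul, integral_const_mul] at key
  have amgm := Real.geom_mean_le_arith_mean2_weighted h1'.le h0.le
    (mul_nonneg (inv_nonneg.2 ha.le) (integral_nonneg (μ := volume) hf0))
    (mul_nonneg (inv_nonneg.2 hb.le) (integral_nonneg (μ := volume) hg0)) (by ring)
  rw [Real.mul_rpow (by positivity) (integral_nonneg hf0),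
    Real.mul_rpow (by positivity) (integral_nonneg hg0), Real.inv_rpow ha.le,
    Real.inv_rpow hb.le] at amgm
  have := amgm.trans key
  rw [← div_eq_inv_mul, ← div_eq_inv_mul, ← div_eq_inv_mul, div_mul_div_comm,
    div_le_div_iff_of_pos_right hcpos] at this
  exact this

/-- By Fubini: the inequality on fibres `F` is the hypothesis for the marginals on `E`. -/
theorem PrekopaLeindlerSpace.prod {E F : Type*}
    [NormedAddCommGroup E] [NormedSpace ℝ E] [ProperSpace E] [MeasureSpace E] [BorelSpace E]
    [NormedAddCommGroup F] [NormedSpace ℝ F] [ProperSpace F] [MeasureSpace F] [BorelSpace F]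
    [IsFiniteMeasureOnCompacts (volume : Measure E)] [SFinite (volume : Measure E)]
    [IsFiniteMeasureOnCompacts (volume : Measure F)] [SFinite (volume : Measure F)]
    (hE : PrekopaLeindlerSpace E) (hF : PrekopaLeindlerSpace F) :
    PrekopaLeindlerSpace (E × F) := by
  have marginal : ∀ f : E × F → ℝ, Continuous f → HasCompactSupport f →
      Continuous (fun x => ∫ y, f (x, y)) ∧ HasCompactSupport (fun x => ∫ y, f (x, y)) ∧
      (∀ x, HasCompactSupport fun y => f (x, y)) ∧ ∫ p, f p = ∫ x, ∫ y, f (x, y) := by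
    intro f hf hfs
    have hzero : ∀ x y, (x, y) ∉ tsupport f → f (x, y) = 0 := fun x y h =>
      image_eq_zero_of_notMem_tsupport h
    have hK₂ : IsCompact (Prod.snd '' tsupport f) := hfs.image continuous_snd
    refine ⟨?_, ?_, ?_, ?_⟩
    · have : (fun x => ∫ y, f (x, y)) = fun x => ∫ y in Prod.snd '' tsupport f, f (x, y) := by
        ext x
        refine (setIntegral_eq_integral_of_forall_compl_eq_zero fun y hy => hzero x y ?_).symm
        exact fun hc => hy ⟨_, hc, rfl⟩
      rw [this]
      exact continuous_parametric_integral_of_continuous (f := fun x y => f (x, y)) hf hK₂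
    · refine HasCompactSupport.intro (hfs.image continuous_fst) fun x hx => ?_
      have : ∀ y, f (x, y) = 0 := fun y => hzero x y fun hc => hx ⟨_, hc, rfl⟩
      simp [this]
    · exact fun x => HasCompactSupport.intro hK₂ fun y hy => hzero x y fun hc => hy ⟨_, hc, rfl⟩
    · exact integral_prod f (hf.integrable_of_hasCompactSupport hfs)
  intro lam f g h h0 h1 hf0 hg0 hh0 hf hg hh hfs hgs hhs H
  obtain ⟨f1, f2, f3, f4⟩ := marginal f hf hfs
  obtain ⟨g1, g2, g3, g4⟩ := marginal g hg hgs
  obtain ⟨i1, i2, i3, i4⟩ := marginal h hh hhs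
  rw [f4, g4, i4]
  refine hE lam _ _ _ h0 h1 (fun x => integral_nonneg fun y => hf0 _)
    (fun x => integral_nonneg fun y => hg0 _) (fun x => integral_nonneg fun y => hh0 _)
    f1 g1 i1 f2 g2 i2 fun y z => ?_
  exact hF lam _ _ _ h0 h1 (fun _ => hf0 _) (fun _ => hg0 _) (fun _ => hh0 _) (by fun_prop)
    (by fun_prop) (by fun_prop) (f3 y) (g3 z) (i3 _) fun y' z' => H (y, y') (z, z')

theorem PrekopaLeindlerSpace.of_equiv {E F : Type*}
    [AddCommGroup E] [Module ℝ E] [TopologicalSpace E] [MeasureSpace E] [BorelSpace E]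
    [AddCommGroup F] [Module ℝ F] [TopologicalSpace F] [MeasureSpace F] [BorelSpace F]
    (hE : PrekopaLeindlerSpace E) (e : E ≃L[ℝ] F) (he : MeasurePreserving e) :
    PrekopaLeindlerSpace F := by
  have hint : ∀ f : F → ℝ, ∫ x, f (e x) = ∫ y, f y := fun f =>
    he.integral_comp e.toHomeomorph.measurableEmbedding f
  intro lam f g h h0 h1 hf0 hg0 hh0 hf hg hh hfs hgs hhs H
  rw [← hint f, ← hint g, ← hint h]
  refine hE lam _ _ _ h0 h1 (fun _ => hf0 _) (fun _ => hg0 _) (fun _ => hh0 _) (by fun_prop)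
    (by fun_prop) (by fun_prop) (hfs.comp_homeomorph e.toHomeomorph)
    (hgs.comp_homeomorph e.toHomeomorph) (hhs.comp_homeomorph e.toHomeomorph) fun y z => ?_
  simpa using H (e y) (e z)

theorem prekopaLeindlerSpace_pi (n : ℕ) : PrekopaLeindlerSpace (Fin n → ℝ) := by
  induction n with
  | zero =>
    intro lam f g h h0 h1 hf0 hg0 hh0 hf hg hh hfs hgs hhs H
    have hint : ∀ u : (Fin 0 → ℝ) → ℝ, ∫ x, u x = u 0 := fun u => by
      rw [Measure.volume_pi_eq_dirac 0, integral_dirac]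
    rw [hint, hint, hint]
    simpa using H 0 0
  | succ n ih =>
    have e : ⇑(Fin.consEquivL ℝ fun _ : Fin (n + 1) => ℝ) =
        (MeasurableEquiv.piFinSuccAbove (fun _ : Fin (n + 1) => ℝ) 0).symm := by
      funext p
      ext i
      refine Fin.cases ?_ (fun j => ?_) i <;> simp [MeasurableEquiv.piFinSuccAbove]
    refine (prekopaLeindlerSpace_real.prod ih).of_equiv
      (Fin.consEquivL ℝ fun _ : Fin (n + 1) => ℝ) ?_
    rw [e]
    exact (volume_preserving_piFinSuccAbove (fun _ : Fin (n + 1) => ℝ) 0).symm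

theorem prekopaLeindlerSpace_euclideanSpace (n : ℕ) :
    PrekopaLeindlerSpace (EuclideanSpace ℝ (Fin n)) :=
  (prekopaLeindlerSpace_pi n).of_equiv (EuclideanSpace.equiv (Fin n) ℝ).symm
    (PiLp.volume_preserving_toLp (Fin n))

/-! ### Monotone transport and the equality case on the line -/

theorem exists_antideriv_range_eq_Ioo {F : ℝ → ℝ} (hF : Continuous F) (hpos : ∀ x, 0 < F x)
    (hint : Integrable F) (h1 : ∫ x, F x = 1) :
    ∃ Φ : ℝ → ℝ, (∀ x, HasDerivAt Φ (F x) x) ∧ StrictMono Φ ∧ range Φ = Ioo 0 1 := by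
  set Φ : ℝ → ℝ := fun x => ∫ t in Iic x, F t with hΦ
  have hderiv : ∀ x, HasDerivAt Φ (F x) x := by
    intro x
    have e : Φ = fun y => Φ 0 + ∫ t in (0 : ℝ)..y, F t := by
      ext y
      rw [← intervalIntegral.integral_Iic_sub_Iic hint.integrableOn hint.integrableOn]
      simp [hΦ]
    rw [e]
    exact (intervalIntegral.integral_hasDerivAt_right (hF.intervalIntegrable _ _)
      hF.stronglyMeasurable.stronglyMeasurableAtFilter hF.continuousAt).const_add _
  have hmono : StrictMono Φ := strictMono_of_hasDerivAt_pos hderiv hpos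
  have hbot : Tendsto Φ atBot (𝓝 0) := tendsto_integral_Iic_zero tendsto_id
  have htop : Tendsto Φ atTop (𝓝 1) := by
    rw [← h1]
    exact (aecover_Iic (μ := volume) (b := id) tendsto_id).integral_tendsto_of_countably_generated
      hint
  have hcont : Continuous Φ := continuous_iff_continuousAt.2 fun x => (hderiv x).continuousAt
  refine ⟨Φ, hderiv, hmono, Subset.antisymm ?_ ?_⟩
  · rintro _ ⟨x, rfl⟩
    exact ⟨(hmono.monotone.le_of_tendsto hbot (x - 1)).trans_lt (hmono (by linarith)),
      (hmono (by linarith)).trans_le (hmono.monotone.ge_of_tendsto htop (x + 1))⟩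
  · rintro p ⟨hp0, hp1⟩
    obtain ⟨a, ha⟩ := (hbot.eventually_lt_const hp0).exists
    obtain ⟨b, hb⟩ := (htop.eventually_const_lt hp1).exists
    exact mem_range_of_exists_le_of_exists_ge hcont ⟨a, ha.le⟩ ⟨b, hb.le⟩

/-- Monotone transport between two continuous positive probability densities on the line. -/
theorem exists_transport_hasDerivAt {F G : ℝ → ℝ} (hF : Continuous F) (hG : Continuous G)
    (hFpos : ∀ x, 0 < F x) (hGpos : ∀ x, 0 < G x) (hFi : Integrable F) (hGi : Integrable G)
    (hF1 : ∫ x, F x = 1) (hG1 : ∫ x, G x = 1) :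
    ∃ T : ℝ → ℝ, ∀ x, HasDerivAt T (F x / G (T x)) x := by
  obtain ⟨Φ, hΦd, hΦm, hΦr⟩ := exists_antideriv_range_eq_Ioo hF hFpos hFi hF1
  obtain ⟨Ψ, hΨd, hΨm, hΨr⟩ := exists_antideriv_range_eq_Ioo hG hGpos hGi hG1
  have hex : ∀ x, ∃ y, Ψ y = Φ x := fun x => by
    have : Φ x ∈ range Ψ := by rw [hΨr, ← hΦr]; exact mem_range_self x
    exact this
  choose T hT using hex
  have hTm : StrictMono T := fun x y hxy => by
    rw [← hΨm.lt_iff_lt, hT, hT]; exact hΦm hxy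
  have hTs : Function.Surjective T := fun y => by
    have : Ψ y ∈ range Φ := by rw [hΦr, ← hΨr]; exact mem_range_self y
    obtain ⟨x, hx⟩ := this
    exact ⟨x, hΨm.injective (by rw [hT, hx])⟩
  have hTc : Continuous T := hTm.monotone.continuous_of_surjective hTs
  refine ⟨T, fun x => ?_⟩
  -- Near `x`, `T` is the local inverse of `Ψ` composed with `Φ`; continuity of `G` gives the strict
  -- derivative needed for that inverse.
  have hs : HasStrictDerivAt Ψ (G (T x)) (T x) :=
    hasStrictDerivAt_of_hasDerivAt_of_continuousAt (.of_forall hΨd) hG.continuousAt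
  have hinv := (hs.to_localInverse (hGpos _).ne').hasDerivAt
  rw [hT] at hinv
  have hcomp := hinv.comp x (hΦd x)
  rw [← div_eq_inv_mul] at hcomp
  refine hcomp.congr_of_eventuallyEq ?_
  have hl := (hs.hasStrictFDerivAt_equiv (hGpos (T x)).ne').eventually_left_inverse
  filter_upwards [hTc.continuousAt.eventually hl] with y hy
  rw [hT] at hy
  exact hy.symm

theorem Real.eq_one_of_rpow_eq_affine {lam r : ℝ} (h0 : 0 < lam) (h1 : lam < 1) (hr : 0 ≤ r)
    (h : 1 - lam + lam * r ≤ r ^ lam) : r = 1 := by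
  by_contra hne
  have := rpow_one_add_lt_one_add_mul_self (s := r - 1) (by linarith) (sub_ne_zero.2 hne)
    h0 h1
  rw [add_sub_cancel] at this
  linarith

/-- Equality case of the Prékopa–Leindler inequality on the line for positive densities. -/
theorem exists_translate_of_prekopaLeindler_eq {lam : ℝ} (h0 : 0 < lam) (h1 : lam < 1)
    {F G H : ℝ → ℝ} (hF : Continuous F) (hG : Continuous G) (hH : Continuous H)
    (hFpos : ∀ x, 0 < F x) (hGpos : ∀ x, 0 < G x) (hHpos : ∀ x, 0 < H x)
    (hFi : Integrable F) (hGi : Integrable G) (hHi : Integrable H)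
    (hF1 : ∫ x, F x = 1) (hG1 : ∫ x, G x = 1) (hH1 : ∫ x, H x = 1)
    (hineq : ∀ y z, F y ^ (1 - lam) * G z ^ lam ≤ H ((1 - lam) * y + lam * z)) :
    ∃ η : ℝ, ∀ x, F x = G (x + η) ∧ F x = H (x + lam * η) := by
  obtain ⟨T, hT⟩ := exists_transport_hasDerivAt hF hG hFpos hGpos hFi hGi hF1 hG1
  have hTc : Continuous T := continuous_iff_continuousAt.2 fun x => (hT x).continuousAt
  set r : ℝ → ℝ := fun x => F x / G (T x) with hr
  have hrpos : ∀ x, 0 < r x := fun x => div_pos (hFpos x) (hGpos _)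
  have hrc : Continuous r := hF.div (hG.comp hTc) fun x => (hGpos _).ne'
  set S : ℝ → ℝ := fun x => (1 - lam) * x + lam * T x with hS
  set S' : ℝ → ℝ := fun x => 1 - lam + lam * r x with hS'
  have hS'pos : ∀ x, 0 < S' x := fun x => by
    have := mul_pos h0 (hrpos x)
    simp only [hS']; linarith
  have hSd : ∀ x, HasDerivAt S (S' x) x := fun x => by
    simpa only [mul_one] using
      ((hasDerivAt_id' x).const_mul (1 - lam)).fun_add ((hT x).const_mul lam)
  have hSc : Continuous S := by fun_prop
  have hSinj : Function.Injective S := (strictMono_of_hasDerivAt_pos hSd hS'pos).injective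
  have hI : Integrable fun x => S' x * H (S x) := by
    have := (integrableOn_image_iff_integrableOn_abs_deriv_smul MeasurableSet.univ
      (fun x _ => (hSd x).hasDerivWithinAt) hSinj.injOn H).1 hHi.integrableOn
    rw [integrableOn_univ] at this
    simpa [abs_of_pos (hS'pos _)] using this
  -- Change of variables over the range of `S`; surjectivity is not needed, as only an upper bound
  -- is used.
  have hle : ∫ x, S' x * H (S x) ≤ 1 := by
    have := integral_image_eq_integral_abs_deriv_smul MeasurableSet.univ
      (fun x _ => (hSd x).hasDerivWithinAt) hSinj.injOn H
    simp only [abs_of_pos (hS'pos _), smul_eq_mul, setIntegral_univ] at this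
    rw [← this, ← hH1]
    exact setIntegral_le_integral hHi (.of_forall fun x => (hHpos x).le)
  have hgeom : ∀ x, F x = r x ^ lam * (F x ^ (1 - lam) * G (T x) ^ lam) := fun x => by
    have e : r x * G (T x) = F x := div_mul_cancel₀ _ (hGpos _).ne'
    calc F x = F x ^ lam * F x ^ (1 - lam) := by rw [← Real.rpow_add (hFpos x)]; simp
      _ = (r x * G (T x)) ^ lam * F x ^ (1 - lam) := by rw [e]
      _ = _ := by rw [Real.mul_rpow (hrpos x).le (hGpos _).le]; ring
  have hamgm : ∀ x, r x ^ lam ≤ S' x := fun x => by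
    have := rpow_one_add_le_one_add_mul_self (s := r x - 1) (by linarith [hrpos x])
      h0.le h1.le
    rw [add_sub_cancel] at this
    simp only [hS']; linarith
  have hlow : ∀ x, F x ≤ r x ^ lam * H (S x) := fun x => by
    conv_lhs => rw [hgeom x]
    exact mul_le_mul_of_nonneg_left (hineq x (T x)) (Real.rpow_nonneg (hrpos x).le _)
  have hup : ∀ x, r x ^ lam * H (S x) ≤ S' x * H (S x) := fun x =>
    mul_le_mul_of_nonneg_right (hamgm x) (hHpos _).le
  -- A nonnegative continuous function with nonpositive integral vanishes everywhere.
  have hzero : (fun x => S' x * H (S x) - F x) = 0 := by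
    refine (Continuous.ae_eq_iff_eq volume (by fun_prop) continuous_const).1
      ((integral_eq_zero_iff_of_nonneg (fun x => ?_) (hI.sub hFi)).1 ?_)
    · exact sub_nonneg.2 ((hlow x).trans (hup x))
    · refine le_antisymm ?_ (integral_nonneg fun x => sub_nonneg.2 ((hlow x).trans (hup x)))
      have := integral_sub hI hFi
      rw [hF1] at this
      exact this.trans_le (by linarith)
  have heq : ∀ x, S' x * H (S x) = F x := fun x => sub_eq_zero.1 (congrFun hzero x)
  have hr1 : ∀ x, r x = 1 := fun x =>
    Real.eq_one_of_rpow_eq_affine h0 h1 (hrpos x).le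
      (le_of_mul_le_mul_right ((heq x).trans_le (hlow x)) (hHpos (S x)))
  have hTx : ∀ x, T x = x + T 0 := fun x => by
    have := is_const_of_deriv_eq_zero (f := fun y => T y - y)
      (fun y => ((hT y).fun_sub (hasDerivAt_id' y)).differentiableAt)
      (fun y => by
        rw [((hT y).fun_sub (hasDerivAt_id' y)).deriv]
        exact sub_eq_zero.2 (hr1 y)) x 0
    simp only [sub_zero] at this
    linarith
  refine ⟨T 0, fun x => ⟨?_, ?_⟩⟩
  · rw [← hTx]
    exact (div_eq_one_iff_eq (hGpos _).ne').1 (hr1 x)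
  · rw [← heq x]
    simp only [hS', hS, hr1, hTx x]
    ring_nf

/-! ### Log-concavity from a single weight -/

/-- Continuity upgrades log-concavity for a single weight to all weights. -/
theorem isLogConcave_of_continuous {n : ℕ} {v : EuclideanSpace ℝ (Fin n) → ℝ}
    (hv0 : ∀ x, 0 ≤ v x) (hv : Continuous v) {lam : ℝ} (h0 : 0 < lam) (h1 : lam < 1)
    (H : ∀ y z, v y ^ (1 - lam) * v z ^ lam ≤ v ((1 - lam) • y + lam • z)) :
    IsLogConcave v := by
  refine ⟨hv0, fun y z μ hμ0 hμ1 => ?_⟩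
  by_cases hy : v y = 0
  · rw [hy, Real.zero_rpow (by linarith), zero_mul]; exact hv0 _
  by_cases hz : v z = 0
  · rw [hz, Real.zero_rpow hμ0.ne', mul_zero]; exact hv0 _
  have hy' := (hv0 y).lt_of_ne' hy
  have hz' := (hv0 z).lt_of_ne' hz
  set A : Set ℝ := {t | v y ^ (1 - t) * v z ^ t ≤ v ((1 - t) • y + t • z)} with hA
  have hAc : IsClosed A := by
    refine isClosed_le (Continuous.mul ?_ ?_) (by fun_prop)
    · exact continuous_const.rpow (by fun_prop) fun _ => .inl hy
    · exact continuous_const.rpow (by fun_prop) fun _ => .inl hz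
  have hcomb : ∀ s ∈ A, ∀ t ∈ A, (1 - lam) * s + lam * t ∈ A := by
    intro s hs t ht
    have e : (1 - ((1 - lam) * s + lam * t)) • y + ((1 - lam) * s + lam * t) • z =
        (1 - lam) • ((1 - s) • y + s • z) + lam • ((1 - t) • y + t • z) := by module
    rw [hA, mem_ofPred_eq, e]
    refine le_trans (le_of_eq ?_) ((mul_le_mul (Real.rpow_le_rpow (by positivity) hs (by linarith))
      (Real.rpow_le_rpow (by positivity) ht h0.le) (by positivity)
      (Real.rpow_nonneg (hv0 _) _)).trans (H _ _))
    rw [Real.mul_rpow (by positivity) (by positivity),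
      Real.mul_rpow (by positivity) (by positivity), ← Real.rpow_mul hy'.le, ← Real.rpow_mul hz'.le, ← Real.rpow_mul hy'.le,
      ← Real.rpow_mul hz'.le,
      mul_mul_mul_comm, ← Real.rpow_add hy', ← Real.rpow_add hz']
    ring_nf
  have h0A : (0 : ℝ) ∈ A := by simp [hA]
  have h1A : (1 : ℝ) ∈ A := by simp [hA]
  by_contra hμ
  have hμA : μ ∉ A := hμ
  have hcompact : ∀ p q : ℝ, IsCompact (A ∩ Icc p q) := fun p q => isCompact_Icc.inter_left hAc
  -- If `μ` is missed, it lies in a maximal gap of the closed set `A`, but the `lam`-combination of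
  -- the gap's endpoints is in `A` and inside the gap.
  obtain ⟨a, ⟨haA, ha⟩, hamax⟩ := (hcompact 0 μ).exists_isGreatest ⟨0, h0A, le_rfl, hμ0.le⟩
  obtain ⟨b, ⟨hbA, hb⟩, hbmin⟩ := (hcompact μ 1).exists_isLeast ⟨1, h1A, hμ1.le, le_rfl⟩
  have haμ : a < μ := ha.2.lt_of_ne fun h => hμA (h ▸ haA)
  have hμb : μ < b := hb.1.lt_of_ne fun h => hμA (h ▸ hbA)
  have hc := hcomb a haA b hbA
  set c := (1 - lam) * a + lam * b with hc_def
  have hac : a < c := by nlinarith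
  have hcb : c < b := by nlinarith
  rcases le_total c μ with h | h
  · exact absurd (hamax ⟨hc, ha.1.trans hac.le, h⟩) (not_le.2 hac)
  · exact absurd (hbmin ⟨hc, h, hcb.le.trans hb.2⟩) (not_le.2 hcb)

theorem IsLogConcave.const_mul_comp_sub {n : ℕ} {v : EuclideanSpace ℝ (Fin n) → ℝ}
    (hv : IsLogConcave v) {c : ℝ} (hc : 0 < c) (b : EuclideanSpace ℝ (Fin n)) :
    IsLogConcave fun x => c * v (x - b) := by
  refine ⟨fun x => mul_nonneg hc.le (hv.1 _), fun y z μ hμ0 hμ1 => ?_⟩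
  have e : (1 - μ) • y + μ • z - b = (1 - μ) • (y - b) + μ • (z - b) := by module
  rw [Real.mul_rpow hc.le (hv.1 _), Real.mul_rpow hc.le (hv.1 _), mul_mul_mul_comm,
    ← Real.rpow_add hc, sub_add_cancel, Real.rpow_one]
  beta_reduce
  rw [e]
  exact mul_le_mul_of_nonneg_left (hv.2 _ _ μ hμ0 hμ1) hc.le

/-! ### Gaussian densities and smoothed marginals -/

theorem gaussianPDFReal_one_eq (a s : ℝ) :
    gaussianPDFReal a 1 s = (√(2 * Real.pi))⁻¹ * Real.exp (-(s - a) ^ 2 / 2) := by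
  simp [gaussianPDFReal]

theorem continuous_gaussianPDFReal_one :
    Continuous fun p : ℝ × ℝ => gaussianPDFReal p.1 1 p.2 := by
  simp only [gaussianPDFReal_one_eq]
  fun_prop

theorem gaussianPDFReal_one_le {a R : ℝ} (h : |a| ≤ R) (s : ℝ) :
    gaussianPDFReal a 1 s ≤
      (√(2 * Real.pi))⁻¹ * Real.exp (R ^ 2 / 2) * Real.exp (-(1 / 4) * s ^ 2) := by
  rw [gaussianPDFReal_one_eq, mul_assoc, ← Real.exp_add]
  have h2 : a ^ 2 ≤ R ^ 2 := sq_le_sq' (by linarith [neg_abs_le a]) ((le_abs_self a).trans h)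
  gcongr
  nlinarith [sq_nonneg (s - 2 * a)]

/-- The exponent is a concave quadratic in the difference of point and mean. -/
theorem gaussianPDFReal_one_logConcave {lam : ℝ} (h0 : 0 < lam) (h1 : lam < 1) (a b s t : ℝ) :
    gaussianPDFReal a 1 s ^ (1 - lam) * gaussianPDFReal b 1 t ^ lam ≤
      gaussianPDFReal ((1 - lam) * a + lam * b) 1 ((1 - lam) * s + lam * t) := by
  have hc : 0 < (√(2 * Real.pi))⁻¹ := by positivity
  simp only [gaussianPDFReal_one_eq]
  rw [Real.mul_rpow hc.le (Real.exp_pos _).le, Real.mul_rpow hc.le (Real.exp_pos _).le,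
    mul_mul_mul_comm, ← Real.rpow_add hc, ← Real.exp_mul, ← Real.exp_mul, ← Real.exp_add,
    sub_add_cancel, Real.rpow_one]
  gcongr
  nlinarith [mul_nonneg (mul_nonneg h0.le (sub_nonneg.2 h1.le)) (sq_nonneg ((s - a) - (t - b)))]

theorem continuous_mul_gaussianPDFReal {E : Type*} [NormedAddCommGroup E]
    [InnerProductSpace ℝ E] {f : E → ℝ} (hf : Continuous f) (u : E) (s : ℝ) :
    Continuous fun x => f x * gaussianPDFReal ⟪u, x⟫_ℝ 1 s :=
  hf.mul (continuous_gaussianPDFReal_one.comp (by fun_prop : Continuous fun x : E =>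
    (⟪u, x⟫_ℝ, s)))

section GaussianMarginal

variable {E : Type*} [NormedAddCommGroup E] [InnerProductSpace ℝ E] [FiniteDimensional ℝ E]
  [MeasurableSpace E] [BorelSpace E]

/-- The marginal of `f` in direction `u`, convolved with a standard Gaussian. -/
noncomputable def gaussianMarginal (f : E → ℝ) (u : E) (s : ℝ) : ℝ :=
  ∫ x, f x * gaussianPDFReal ⟪u, x⟫_ℝ 1 s

variable {V : Type*} [NormedAddCommGroup V] [NormedSpace ℝ V]

/-- Means stay bounded on the support of `f`, so one Gaussian tail dominates. Linear growth of `φ`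
covers the tests used later: constants, the identity and the complex exponential. -/
theorem integrable_prod_gaussian {f : E → ℝ} (hf : Continuous f) (hfs : HasCompactSupport f)
    (u : E) {φ : ℝ → V} (hφ : Continuous φ) (hb : ∀ s, ‖φ s‖ ≤ 1 + |s|) :
    Integrable (fun p : E × ℝ => (f p.1 * gaussianPDFReal ⟪u, p.1⟫_ℝ 1 p.2) • φ p.2)
      (volume.prod volume) := by
  obtain ⟨R, hR⟩ := hfs.isCompact.exists_bound_of_continuousOn
    (f := fun x => ⟪u, x⟫_ℝ) (by fun_prop)
  have hint : Integrable fun s : ℝ => (1 + |s|) * Real.exp (-(1 / 4) * s ^ 2) := by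
    have e1 := integrable_exp_neg_mul_sq (b := 1 / 4) (by norm_num)
    have e2 := (integrable_mul_exp_neg_mul_sq (b := 1 / 4) (by norm_num)).norm
    refine (e1.add e2).congr (.of_forall fun s => ?_)
    simp only [Pi.add_apply, norm_mul, Real.norm_eq_abs, Real.abs_exp]
    ring
  refine (((hf.integrable_of_hasCompactSupport hfs).norm.const_mul
    ((√(2 * Real.pi))⁻¹ * Real.exp (R ^ 2 / 2))).mul_prod hint).mono' ?_ (.of_forall ?_)
  · have hg : Continuous fun p : E × ℝ => gaussianPDFReal ⟪u, p.1⟫_ℝ 1 p.2 :=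
      continuous_gaussianPDFReal_one.comp (by fun_prop : Continuous fun p : E × ℝ =>
        (⟪u, p.1⟫_ℝ, p.2))
    have : Continuous fun p : E × ℝ =>
      (f p.1 * gaussianPDFReal ⟪u, p.1⟫_ℝ 1 p.2) • φ p.2 := by fun_prop
    exact this.aestronglyMeasurable
  · rintro ⟨x, s⟩
    simp only [norm_smul, norm_mul]
    by_cases hx : x ∈ tsupport f
    · rw [Real.norm_of_nonneg (gaussianPDFReal_nonneg _ _ _)]
      calc _ ≤ ‖f x‖ * ((√(2 * Real.pi))⁻¹ * Real.exp (R ^ 2 / 2) *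
              Real.exp (-(1 / 4) * s ^ 2)) * (1 + |s|) := by
            gcongr
            · exact gaussianPDFReal_one_le (hR x hx) s
            · exact hb s
        _ = _ := by ring
    · simp [image_eq_zero_of_notMem_tsupport hx]

theorem gaussianMarginal_smul [CompleteSpace V] (f : E → ℝ) (u : E) (φ : ℝ → V) (s : ℝ) :
    gaussianMarginal f u s • φ s =
      ∫ x, (f x * gaussianPDFReal ⟪u, x⟫_ℝ 1 s) • φ s := by
  rw [gaussianMarginal, integral_smul_const]

theorem integrable_gaussianMarginal_smul [CompleteSpace V] {f : E → ℝ} (hf : Continuous f)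
    (hfs : HasCompactSupport f)
    (u : E) {φ : ℝ → V} (hφ : Continuous φ) (hb : ∀ s, ‖φ s‖ ≤ 1 + |s|) :
    Integrable fun s => gaussianMarginal f u s • φ s := by
  simp only [gaussianMarginal_smul]
  exact (integrable_prod_gaussian hf hfs u hφ hb).integral_prod_right

theorem integral_gaussianMarginal_smul [CompleteSpace V] {f : E → ℝ} (hf : Continuous f)
    (hfs : HasCompactSupport f)
    (u : E) {φ : ℝ → V} (hφ : Continuous φ) (hb : ∀ s, ‖φ s‖ ≤ 1 + |s|) :
    ∫ s, gaussianMarginal f u s • φ s = ∫ x, f x • ∫ s, φ s ∂(gaussianReal ⟪u, x⟫_ℝ 1) := by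
  simp only [gaussianMarginal_smul]
  rw [← integral_integral_swap (f := fun x s => (f x * gaussianPDFReal ⟪u, x⟫_ℝ 1 s) • φ s)
    (integrable_prod_gaussian hf hfs u hφ hb)]
  refine integral_congr_ae (.of_forall fun x => ?_)
  simp only [mul_smul]
  rw [integral_smul, integral_gaussianReal_eq_integral_smul one_ne_zero]

theorem integrable_gaussianMarginal {f : E → ℝ} (hf : Continuous f) (hfs : HasCompactSupport f)
    (u : E) : Integrable (gaussianMarginal f u) := by
  simpa using integrable_gaussianMarginal_smul hf hfs u (φ := fun _ => (1 : ℝ))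
    continuous_const (by simp)

theorem integral_gaussianMarginal {f : E → ℝ} (hf : Continuous f) (hfs : HasCompactSupport f)
    (u : E) : ∫ s, gaussianMarginal f u s = ∫ x, f x := by
  simpa using integral_gaussianMarginal_smul hf hfs u (φ := fun _ => (1 : ℝ))
    continuous_const (by simp)

theorem integral_gaussianMarginal_mul_id {f : E → ℝ} (hf : Continuous f)
    (hfs : HasCompactSupport f) (u : E) :
    ∫ s, gaussianMarginal f u s * s = ⟪u, ∫ x, f x • x⟫_ℝ := by
  have h := integral_gaussianMarginal_smul hf hfs u (φ := fun s : ℝ => s) continuous_id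
    (fun s => by simp)
  simp only [smul_eq_mul, integral_id_gaussianReal] at h
  have hi : Integrable fun x => f x • x :=
    (by fun_prop : Continuous fun x => f x • x).integrable_of_hasCompactSupport hfs.smul_right
  rw [h, ← integral_inner hi]
  simp [real_inner_smul_right]

/-- Frequency one suffices because `u` ranges over the whole space; the Gaussian contributes only a
nonzero constant. -/
theorem integral_gaussianMarginal_mul_exp {f : E → ℝ} (hf : Continuous f)
    (hfs : HasCompactSupport f) (u : E) :
    ∫ s, gaussianMarginal f u s • Complex.exp (s * Complex.I) =
      (∫ x, f x • Complex.exp (⟪u, x⟫_ℝ * Complex.I)) * Complex.exp (-(1 / 2)) := by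
  rw [integral_gaussianMarginal_smul hf hfs u (φ := fun s : ℝ => Complex.exp (s * Complex.I))
    (by fun_prop) (fun s => by simp [Complex.norm_exp_ofReal_mul_I]), ← integral_mul_const]
  refine integral_congr_ae (.of_forall fun x => ?_)
  have h := charFun_gaussianReal (μ := ⟪u, x⟫_ℝ) (v := 1) 1
  rw [charFun_apply_real] at h
  simp only [Complex.ofReal_one, one_mul] at h
  simp only [h, smul_mul_assoc, ← Complex.exp_add]
  congr 2
  simp
  ring

theorem continuous_gaussianMarginal {f : E → ℝ} (hf : Continuous f) (hfs : HasCompactSupport f)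
    (u : E) : Continuous (gaussianMarginal f u) := by
  have : gaussianMarginal f u =
      fun s => ∫ x in tsupport f, f x * gaussianPDFReal ⟪u, x⟫_ℝ 1 s := by
    ext s
    refine (setIntegral_eq_integral_of_forall_compl_eq_zero fun x hx => ?_).symm
    rw [image_eq_zero_of_notMem_tsupport hx, zero_mul]
  rw [this]
  refine continuous_parametric_integral_of_continuous
    (f := fun s x => f x * gaussianPDFReal ⟪u, x⟫_ℝ 1 s) ?_ hfs
  have hg : Continuous fun p : ℝ × E => gaussianPDFReal ⟪u, p.2⟫_ℝ 1 p.1 :=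
    continuous_gaussianPDFReal_one.comp (by fun_prop : Continuous fun p : ℝ × E =>
      (⟪u, p.2⟫_ℝ, p.1))
  exact (hf.comp continuous_snd).mul hg

theorem gaussianMarginal_pos {f : E → ℝ} (hf0 : ∀ x, 0 ≤ f x) (hf : Continuous f)
    (hfs : HasCompactSupport f) (hpos : 0 < ∫ x, f x) (u : E) (s : ℝ) :
    0 < gaussianMarginal f u s := by
  obtain ⟨a, ha, -⟩ := exists_forall_le_and_pos hf0 hf hfs hpos.ne'
  exact (continuous_mul_gaussianPDFReal hf u s).integral_pos_of_hasCompactSupport_nonneg_nonzero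
    hfs.mul_right (fun x => mul_nonneg (hf0 x) (gaussianPDFReal_nonneg _ _ _))
    (x := a) (mul_pos ha (gaussianPDFReal_pos _ _ _ one_ne_zero)).ne'

theorem gaussianMarginal_prekopaLeindler (hE : PrekopaLeindlerSpace E) {lam : ℝ} (h0 : 0 < lam)
    (h1 : lam < 1) {f g h : E → ℝ} (hf0 : ∀ x, 0 ≤ f x) (hg0 : ∀ x, 0 ≤ g x) (hh0 : ∀ x, 0 ≤ h x)
    (hf : Continuous f) (hg : Continuous g) (hh : Continuous h)
    (hfs : HasCompactSupport f) (hgs : HasCompactSupport g) (hhs : HasCompactSupport h)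
    (H : ∀ y z, f y ^ (1 - lam) * g z ^ lam ≤ h ((1 - lam) • y + lam • z)) (u : E) (s t : ℝ) :
    gaussianMarginal f u s ^ (1 - lam) * gaussianMarginal g u t ^ lam ≤
      gaussianMarginal h u ((1 - lam) * s + lam * t) := by
  have hγ := gaussianPDFReal_nonneg
  refine hE lam _ _ _ h0 h1 (fun x => mul_nonneg (hf0 x) (hγ _ _ _))
    (fun x => mul_nonneg (hg0 x) (hγ _ _ _)) (fun x => mul_nonneg (hh0 x) (hγ _ _ _))
    (continuous_mul_gaussianPDFReal hf u s) (continuous_mul_gaussianPDFReal hg u t)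
    (continuous_mul_gaussianPDFReal hh u _) hfs.mul_right hgs.mul_right hhs.mul_right
    fun y z => ?_
  rw [Real.mul_rpow (hf0 y) (hγ _ _ _), Real.mul_rpow (hg0 z) (hγ _ _ _), mul_mul_mul_comm,
    inner_add_right, real_inner_smul_right, real_inner_smul_right]
  exact mul_le_mul (H y z) (gaussianPDFReal_one_logConcave h0 h1 _ _ _ _)
    (mul_nonneg (Real.rpow_nonneg (hγ _ _ _) _) (Real.rpow_nonneg (hγ _ _ _) _)) (hh0 _)

/-- The centred Gaussian noise leaves first moments unchanged, so the shift is read off from the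
barycentres. -/
theorem shift_eq_inner_of_gaussianMarginal_translate {f g : E → ℝ}
    (hf : Continuous f) (hg : Continuous g) (hfs : HasCompactSupport f)
    (hgs : HasCompactSupport g) (hg1 : ∫ x, g x = 1) {u : E} {c : ℝ}
    (h : ∀ s, gaussianMarginal f u s = gaussianMarginal g u (s + c)) :
    c = ⟪u, (∫ x, g x • x) - ∫ x, f x • x⟫_ℝ := by
  have e := integral_gaussianMarginal_mul_id hf hfs u
  have hgi : Integrable fun s => gaussianMarginal g u s * s := by
    simpa using integrable_gaussianMarginal_smul hg hgs u (φ := fun s : ℝ => s) continuous_id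
      (fun s => by simp)
  have e2 : ∫ s, gaussianMarginal f u s * s = ⟪u, ∫ x, g x • x⟫_ℝ - c := by
    calc ∫ s, gaussianMarginal f u s * s
        = ∫ s, gaussianMarginal g u (s + c) * (s + c - c) := by simp only [h, add_sub_cancel_right]
      _ = ∫ s, gaussianMarginal g u s * (s - c) :=
          integral_add_right_eq_self (fun s => gaussianMarginal g u s * (s - c)) c
      _ = ∫ s, (gaussianMarginal g u s * s - gaussianMarginal g u s * c) := by
          simp only [mul_sub]
      _ = _ := by
          rw [integral_sub hgi ((integrable_gaussianMarginal hg hgs u).mul_const c),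
            integral_mul_const, integral_gaussianMarginal hg hgs, hg1, one_mul,
            integral_gaussianMarginal_mul_id hg hgs]
  rw [inner_sub_right]
  linarith

/-! ### Recovering functions from their marginals by Fourier transform -/

theorem charFun_withDensity_ofReal {f : E → ℝ} (hf0 : ∀ x, 0 ≤ f x) (hf : Continuous f) (u : E) :
    charFun (volume.withDensity fun x => ENNReal.ofReal (f x)) u =
      ∫ x, f x • Complex.exp (⟪u, x⟫_ℝ * Complex.I) := by
  rw [charFun_apply, integral_withDensity_eq_integral_toReal_smul (by fun_prop) (by simp)]
  refine integral_congr_ae (.of_forall fun x => ?_)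
  simp only [ENNReal.toReal_ofReal (hf0 x), real_inner_comm]

/-- A continuous compactly supported function is determined by its Fourier transform. -/
theorem eq_of_integral_exp_inner_eq {f g : E → ℝ} (hf0 : ∀ x, 0 ≤ f x) (hg0 : ∀ x, 0 ≤ g x)
    (hf : Continuous f) (hg : Continuous g) (hfs : HasCompactSupport f)
    (hgs : HasCompactSupport g)
    (h : ∀ u : E, ∫ x, f x • Complex.exp (⟪u, x⟫_ℝ * Complex.I) =
      ∫ x, g x • Complex.exp (⟪u, x⟫_ℝ * Complex.I)) : f = g := by
  have hfi := hf.integrable_of_hasCompactSupport (μ := volume) hfs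
  have hgi := hg.integrable_of_hasCompactSupport (μ := volume) hgs
  have : IsFiniteMeasure (volume.withDensity fun x => ENNReal.ofReal (f x)) :=
    isFiniteMeasure_withDensity_ofReal hfi.2
  have : IsFiniteMeasure (volume.withDensity fun x => ENNReal.ofReal (g x)) :=
    isFiniteMeasure_withDensity_ofReal hgi.2
  have hμ : (volume.withDensity fun x => ENNReal.ofReal (f x)) =
      volume.withDensity fun x => ENNReal.ofReal (g x) :=
    Measure.ext_of_charFun (by
      ext u
      rw [charFun_withDensity_ofReal hf0 hf, charFun_withDensity_ofReal hg0 hg, h])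
  rw [withDensity_eq_iff (by fun_prop) (by fun_prop) hfi.lintegral_lt_top.ne] at hμ
  refine (Continuous.ae_eq_iff_eq volume hf hg).1 ?_
  filter_upwards [hμ] with x hx
  exact (ENNReal.ofReal_eq_ofReal_iff (hf0 x) (hg0 x)).1 hx

theorem eq_translate_of_gaussianMarginal_translate {f g : E → ℝ} (hf0 : ∀ x, 0 ≤ f x)
    (hg0 : ∀ x, 0 ≤ g x) (hf : Continuous f) (hg : Continuous g) (hfs : HasCompactSupport f)
    (hgs : HasCompactSupport g) {b : E}
    (h : ∀ u s, gaussianMarginal f u s = gaussianMarginal g u (s + ⟪u, b⟫_ℝ)) (x : E) :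
    f x = g (x + b) := by
  refine congrFun (eq_of_integral_exp_inner_eq (g := fun x => g (x + b)) hf0 (fun _ => hg0 _) hf
    (by fun_prop) hfs (hgs.comp_homeomorph (Homeomorph.addRight b)) fun u => ?_) x
  -- Deconvolution: the Gaussian's Fourier factor is restored on both sides to compare marginals.
  refine mul_right_cancel₀ (Complex.exp_ne_zero (-(1 / 2))) ?_
  have key : ∀ s : ℝ, Complex.exp (((s - ⟪u, b⟫_ℝ : ℝ) : ℂ) * Complex.I) =
      Complex.exp (s * Complex.I) * Complex.exp (-⟪u, b⟫_ℝ * Complex.I) := fun s => by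
    rw [← Complex.exp_add]
    push_cast
    ring_nf
  calc _ = ∫ s, gaussianMarginal f u s • Complex.exp (s * Complex.I) :=
        (integral_gaussianMarginal_mul_exp hf hfs u).symm
    _ = ∫ s, gaussianMarginal g u (s + ⟪u, b⟫_ℝ) •
          Complex.exp (((s + ⟪u, b⟫_ℝ - ⟪u, b⟫_ℝ : ℝ) : ℂ) * Complex.I) := by
        simp only [h, add_sub_cancel_right]
    _ = ∫ s, gaussianMarginal g u s • Complex.exp (((s - ⟪u, b⟫_ℝ : ℝ) : ℂ) * Complex.I) :=
        integral_add_right_eq_self (fun s : ℝ => gaussianMarginal g u s •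
          Complex.exp (((s - ⟪u, b⟫_ℝ : ℝ) : ℂ) * Complex.I)) _
    _ = (∫ x, g x • Complex.exp (⟪u, x⟫_ℝ * Complex.I)) * Complex.exp (-(1 / 2)) *
          Complex.exp (-⟪u, b⟫_ℝ * Complex.I) := by
        simp only [key, ← smul_mul_assoc]
        rw [integral_mul_const, integral_gaussianMarginal_mul_exp hg hgs]
    _ = (∫ x, g x • Complex.exp (((⟪u, x⟫_ℝ - ⟪u, b⟫_ℝ : ℝ) : ℂ) * Complex.I)) *
          Complex.exp (-(1 / 2)) := by
        simp only [key, ← smul_mul_assoc]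
        rw [integral_mul_const]
        ring
    _ = _ := by
        congr 1
        rw [← integral_add_right_eq_self _ b]
        simp only [inner_add_right, add_sub_cancel_right]

/-! ### The equality case in all dimensions -/

theorem exists_translate_of_prekopaLeindler_eq_of_integral_eq_one (hE : PrekopaLeindlerSpace E)
    {lam : ℝ} (h0 : 0 < lam) (h1 : lam < 1) {f g h : E → ℝ}
    (hf0 : ∀ x, 0 ≤ f x) (hg0 : ∀ x, 0 ≤ g x) (hh0 : ∀ x, 0 ≤ h x)
    (hf : Continuous f) (hg : Continuous g) (hh : Continuous h)
    (hfs : HasCompactSupport f) (hgs : HasCompactSupport g) (hhs : HasCompactSupport h)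
    (hf1 : ∫ x, f x = 1) (hg1 : ∫ x, g x = 1) (hh1 : ∫ x, h x = 1)
    (H : ∀ y z, f y ^ (1 - lam) * g z ^ lam ≤ h ((1 - lam) • y + lam • z)) :
    ∃ η : E, ∀ x, f x = g (x + η) ∧ f x = h (x + lam • η) := by
  have hshift : ∀ u : E, ∃ c : ℝ, ∀ s, gaussianMarginal f u s = gaussianMarginal g u (s + c) ∧
      gaussianMarginal f u s = gaussianMarginal h u (s + lam * c) := fun u =>
    exists_translate_of_prekopaLeindler_eq h0 h1 (continuous_gaussianMarginal hf hfs u)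
      (continuous_gaussianMarginal hg hgs u) (continuous_gaussianMarginal hh hhs u)
      (gaussianMarginal_pos hf0 hf hfs (by simp [hf1]) u)
      (gaussianMarginal_pos hg0 hg hgs (by simp [hg1]) u)
      (gaussianMarginal_pos hh0 hh hhs (by simp [hh1]) u)
      (integrable_gaussianMarginal hf hfs u) (integrable_gaussianMarginal hg hgs u)
      (integrable_gaussianMarginal hh hhs u) (by rw [integral_gaussianMarginal hf hfs, hf1])
      (by rw [integral_gaussianMarginal hg hgs, hg1])
      (by rw [integral_gaussianMarginal hh hhs, hh1])
      (gaussianMarginal_prekopaLeindler hE h0 h1 hf0 hg0 hh0 hf hg hh hfs hgs hhs H u)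
  choose c hc using hshift
  set η : E := (∫ x, g x • x) - ∫ x, f x • x with hη
  have hcη : ∀ u, c u = ⟪u, η⟫_ℝ := fun u =>
    shift_eq_inner_of_gaussianMarginal_translate hf hg hfs hgs hg1 fun s => (hc u s).1
  refine ⟨η, fun x => ⟨?_, ?_⟩⟩
  · exact eq_translate_of_gaussianMarginal_translate hf0 hg0 hf hg hfs hgs
      (fun u s => by rw [← hcη]; exact (hc u s).1) x
  · exact eq_translate_of_gaussianMarginal_translate hf0 hh0 hf hh hfs hhs
      (fun u s => by rw [real_inner_smul_right, ← hcη]; exact (hc u s).2) x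

end GaussianMarginal

theorem theorem5p1 (n : ℕ) (hn : 1 ≤ n) (lam : ℝ) (hlam0 : 0 < lam) (hlam1 : lam < 1)
    (φ₀ φ₁ φlam : EuclideanSpace ℝ (Fin n) → ℝ)
    (h₀_nonneg : ∀ x, 0 ≤ φ₀ x) (h₁_nonneg : ∀ x, 0 ≤ φ₁ x) (hlam_nonneg : ∀ x, 0 ≤ φlam x)
    (h₀_cont : Continuous φ₀) (h₁_cont : Continuous φ₁) (hlam_cont : Continuous φlam)
    (h₀_supp : HasCompactSupport φ₀) (h₁_supp : HasCompactSupport φ₁)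
    (hlam_supp : HasCompactSupport φlam)
    (h₀_pos : 0 < ∫ x, φ₀ x) (h₁_pos : 0 < ∫ x, φ₁ x)
    (h_ineq : ∀ y z, φ₀ y ^ (1 - lam) * φ₁ z ^ lam ≤ φlam ((1 - lam) • y + lam • z))
    (h_eq : ∫ x, φlam x = (∫ x, φ₀ x) ^ (1 - lam) * (∫ x, φ₁ x) ^ lam) :
    IsLogConcave φ₀ ∧ IsLogConcave φ₁ ∧ IsLogConcave φlam ∧
      ∃ (η : EuclideanSpace ℝ (Fin n)) (k : ℝ), 0 < k ∧
        ∀ x, φ₀ x = k * φ₁ (x + η) ∧ k * φ₁ (x + η) = k ^ lam * φlam (x + lam • η) := by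
  have h1' : 0 < 1 - lam := by linarith
  set I₀ := ∫ x, φ₀ x
  set I₁ := ∫ x, φ₁ x
  set c := I₀ ^ (1 - lam) * I₁ ^ lam with hc
  have hc_pos : 0 < c := by positivity
  obtain ⟨η, hη⟩ := exists_translate_of_prekopaLeindler_eq_of_integral_eq_one
    (prekopaLeindlerSpace_euclideanSpace n) hlam0 hlam1
    (f := fun x => I₀⁻¹ * φ₀ x) (g := fun x => I₁⁻¹ * φ₁ x) (h := fun x => c⁻¹ * φlam x)
    (fun x => mul_nonneg (inv_nonneg.2 h₀_pos.le) (h₀_nonneg x))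
    (fun x => mul_nonneg (inv_nonneg.2 h₁_pos.le) (h₁_nonneg x))
    (fun x => mul_nonneg (inv_nonneg.2 hc_pos.le) (hlam_nonneg x))
    (by fun_prop) (by fun_prop) (by fun_prop)
    h₀_supp.mul_left h₁_supp.mul_left hlam_supp.mul_left
    (by rw [integral_const_mul]; exact inv_mul_cancel₀ h₀_pos.ne')
    (by rw [integral_const_mul]; exact inv_mul_cancel₀ h₁_pos.ne')
    (by rw [integral_const_mul, h_eq]; exact inv_mul_cancel₀ hc_pos.ne')
    (fun y z => by
      rw [Real.mul_rpow (by positivity) (h₀_nonneg y), Real.mul_rpow (by positivity) (h₁_nonneg z),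
        Real.inv_rpow h₀_pos.le, Real.inv_rpow h₁_pos.le, mul_mul_mul_comm, ← mul_inv]
      exact mul_le_mul_of_nonneg_left (h_ineq y z) (by positivity))
  set k := I₀ / I₁ with hk
  have hk_pos : 0 < k := div_pos h₀_pos h₁_pos
  have hkc : k ^ lam * c = I₀ := by
    rw [hk, hc, Real.div_rpow h₀_pos.le h₁_pos.le]
    have e : I₀ ^ lam * I₀ ^ (1 - lam) = I₀ := by rw [← Real.rpow_add h₀_pos]; simp
    have := (Real.rpow_pos_of_pos h₁_pos lam).ne'
    field_simp
    exact e
  have e₁ : ∀ x, φ₀ x = k * φ₁ (x + η) := fun x => by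
    have h := (hη x).1
    rw [inv_mul_eq_iff_eq_mul₀ h₀_pos.ne'] at h
    rw [h, hk]; ring
  have e₂ : ∀ x, φ₀ x = k ^ lam * φlam (x + lam • η) := fun x => by
    have h := (hη x).2
    rw [inv_mul_eq_iff_eq_mul₀ h₀_pos.ne'] at h
    rw [h, ← mul_assoc]
    nth_rewrite 1 [← hkc]
    rw [mul_assoc (k ^ lam), mul_inv_cancel₀ hc_pos.ne', mul_one]
  have hkl : 0 < k ^ lam := Real.rpow_pos_of_pos hk_pos _
  have hlc : IsLogConcave φ₀ :=
    isLogConcave_of_continuous h₀_nonneg h₀_cont hlam0 hlam1 fun y z => by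
      -- The shift of `z` by `η` moves the combination by `lam • η`, so both `φ₁` and `φlam` turn
      -- into `φ₀`.
      have h := mul_le_mul_of_nonneg_left (h_ineq y (z + η)) hkl.le
      rw [smul_add, ← add_assoc, ← e₂] at h
      refine le_trans (le_of_eq ?_) h
      rw [e₁ z, Real.mul_rpow hk_pos.le (h₁_nonneg _)]
      ring
  have hφ₁ : φ₁ = fun x => k⁻¹ * φ₀ (x - η) := by
    ext x
    rw [e₁, sub_add_cancel, inv_mul_cancel_left₀ hk_pos.ne']
  have hφlam : φlam = fun x => (k ^ lam)⁻¹ * φ₀ (x - lam • η) := by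
    ext x
    rw [e₂, sub_add_cancel, inv_mul_cancel_left₀ hkl.ne']
  refine ⟨hlc, ?_, ?_, η, k, hk_pos, fun x => ⟨e₁ x, (e₁ x).symm.trans (e₂ x)⟩⟩
  · rw [hφ₁]
    exact hlc.const_mul_comp_sub (inv_pos.2 hk_pos) η
  · rw [hφlam]
    exact hlc.const_mul_comp_sub (inv_pos.2 hkl) (lam • η)
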